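/- All graphs are finite and simple and have at least one vertex. A graph $G$ is $(H_1,\ldots,H_p)$-free if none of $H_1,\ldots,H_p$ is isomorphic to an induced subgraph of $G$. A clique cut-set of $G$ is a (possibly empty) clique $K$ of $G$ such that $G\setminus K$ is disconnected, that is, contains two vertices that are not joined by a path; an atom is a graph with no clique cut-set. The clique-width of $G$ is the minimum number of labels needed to construct $G$ by the operations: create a single vertex with label $i$; take the disjoint union of two labelled graphs; add all edges between the vertices with label $i$ and the vertices with label $j$ ($i\ne j$); relabel every vertex with label $i$ to have label $j$. A class of graphs has unbounded clique-width if there is no constant $c$ such that every graph in the class has clique-width at most $c$. Write $P_t$, $C_t$, $K_t$ for the path, cycle and complete graph on $t$ vertices, $K_{1,3}$ for the claw, $+$ for disjoint union, $rG$ for the disjoint union of $r$ copies of $G$, and $\overline{G}$ for the complement of $G$. Lemma. The class of $(C_4,K_{1,3},K_4,\overline{2P_1+P_2})$-free atoms and the class of $(2P_2,K_3+P_1,4P_1,2P_1+P_2)$-free atoms both have unbounded clique-width. -/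

import Mathlib

namespace CliqueWidthAtoms

open SimpleGraph

/-! ## Clique-width -/

/-- Expressions describing how a labelled graph is built with the labels `Fin k`. -/
inductive CWExpr (k : ℕ) : Type
  /-- a single vertex with label `i` -/
  | single (i : Fin k) : CWExpr k
  /-- the disjoint union of two labelled graphs -/
  | union (a b : CWExpr k) : CWExpr k
  /-- add all edges between vertices with label `i` and vertices with label `j`, where `i ≠ j` -/
  | join (i j : Fin k) (hij : i ≠ j) (a : CWExpr k) : CWExpr k
  /-- give the label `j` to every vertex with label `i` -/
  | relabel (i j : Fin k) (a : CWExpr k) : CWExpr k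

namespace CWExpr

variable {k : ℕ}

/-- The vertex set of the constructed graph. -/
def Vert : CWExpr k → Type
  | single _ => Unit
  | union a b => a.Vert ⊕ b.Vert
  | join _ _ _ a => a.Vert
  | relabel _ _ a => a.Vert

/-- The labels of the vertices of the constructed graph. -/
def label : (e : CWExpr k) → e.Vert → Fin k
  | single i => fun _ => i
  | union a b => Sum.elim a.label b.label
  | join _ _ _ a => a.label
  | relabel i j a => fun v => if a.label v = i then j else a.label v

/-- The constructed graph. -/
def graph : (e : CWExpr k) → SimpleGraph e.Vert
  | single _ => (⊥ : SimpleGraph Unit)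
  | union a b => (a.graph ⊕g b.graph : SimpleGraph (a.Vert ⊕ b.Vert))
  | join i j _ a => a.graph ⊔ SimpleGraph.fromRel fun u v => a.label u = i ∧ a.label v = j
  | relabel _ _ a => a.graph

end CWExpr

/-- `G` can be constructed (up to isomorphism) with at most `k` labels. -/
def Constructible {V : Type*} (G : SimpleGraph V) (k : ℕ) : Prop :=
  ∃ e : CWExpr k, Nonempty (e.graph ≃g G)

/-- The clique-width of `G`: the least number of labels with which `G` can be constructed. The
minimum is over a nonempty set when `G` is finite and has a vertex; see
`exists_constructible`. -/
noncomputable def cliqueWidth {V : Type*} (G : SimpleGraph V) : ℕ :=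
  sInf {k : ℕ | Constructible G k}

theorem exists_discrete {n : ℕ} (s : Finset (Fin n)) (hs : s.Nonempty) :
    ∃ e : CWExpr n, Function.Injective e.label ∧ Set.range e.label = (s : Set (Fin n)) ∧
      e.graph = ⊥ := by
  induction hs using Finset.Nonempty.cons_induction with
  | singleton a =>
    refine ⟨.single a, fun _ _ _ => rfl, ?_, rfl⟩
    ext x
    simp only [CWExpr.label, Set.mem_range, Finset.coe_singleton, Set.mem_singleton_iff]
    exact ⟨fun ⟨_, h⟩ => h.symm, fun h => ⟨(), h.symm⟩⟩
  | cons a s ha hs ih =>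
    obtain ⟨e, hinj, hrange, hg⟩ := ih
    refine ⟨.union (.single a) e, ?_, ?_, ?_⟩
    · refine Function.Injective.sumElim (fun _ _ _ => rfl) hinj ?_
      intro _ v h
      apply ha
      have : e.label v ∈ (s : Set (Fin n)) := hrange ▸ Set.mem_range_self v
      rw [← h] at this
      exact this
    · have h1 : Set.range (CWExpr.label (.single a)) = ({a} : Set (Fin n)) := by
        ext x
        exact ⟨fun ⟨_, h⟩ => h.symm, fun h => ⟨(), h.symm⟩⟩
      have h2 := Set.Sum.elim_range (CWExpr.label (.single a)) e.label
      rw [h1, hrange] at h2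
      rw [Finset.coe_cons]
      exact h2
    · change ((⊥ : SimpleGraph Unit) ⊕g e.graph) = ⊥
      rw [hg]
      ext u v
      rcases u with u | u <;> rcases v with v | v <;> simp

theorem exists_edges {n : ℕ} [NeZero n] (E : Finset (Fin n × Fin n))
    (hE : ∀ p ∈ E, p.1 ≠ p.2) :
    ∃ e : CWExpr n, Function.Bijective e.label ∧
      ∀ u v, e.graph.Adj u v ↔
        (e.label u, e.label v) ∈ E ∨ (e.label v, e.label u) ∈ E := by
  induction E using Finset.induction_on with
  | empty =>
    obtain ⟨e, hi, hr, hg⟩ := exists_discrete (Finset.univ : Finset (Fin n)) ⟨0, by simp⟩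
    refine ⟨e, ⟨hi, Set.range_eq_univ.1 (by simpa using hr)⟩, fun u v => ?_⟩
    simp [hg]
  | insert p E hp ih =>
    obtain ⟨e, hb, ha⟩ := ih fun q hq => hE q (Finset.mem_insert_of_mem hq)
    have hne := hE p (Finset.mem_insert_self _ _)
    refine ⟨.join p.1 p.2 hne e, hb, fun (u v : e.Vert) => ?_⟩
    change (e.graph ⊔ SimpleGraph.fromRel
      fun u v => e.label u = p.1 ∧ e.label v = p.2).Adj u v ↔
        (e.label u, e.label v) ∈ insert p E ∨ (e.label v, e.label u) ∈ insert p E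
    rw [SimpleGraph.sup_adj, ha, SimpleGraph.fromRel_adj]
    simp only [Finset.mem_insert, Prod.ext_iff]
    constructor
    · tauto
    · have h1 : e.label u = p.1 → e.label v = p.2 → u ≠ v := by
        rintro h h' rfl
        exact hne (h.symm.trans h')
      have h2 : e.label v = p.1 → e.label u = p.2 → u ≠ v := by
        rintro h h' rfl
        exact hne (h.symm.trans h')
      tauto

/-- Every finite graph with at least one vertex can be constructed with as many labels as it has
vertices. -/
theorem exists_constructible {V : Type*} [Finite V] [Nonempty V] (G : SimpleGraph V) :
    Constructible G (Nat.card V) := by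
  classical
  have : NeZero (Nat.card V) := ⟨Nat.card_pos.ne'⟩
  let f : V ≃ Fin (Nat.card V) := Finite.equivFin V
  obtain ⟨e, hb, ha⟩ := exists_edges
    (Finset.univ.filter fun p : Fin (Nat.card V) × Fin (Nat.card V) =>
      G.Adj (f.symm p.1) (f.symm p.2))
    (by
      intro p h hp
      rw [Finset.mem_filter, hp] at h
      exact G.loopless.irrefl _ h.2)
  refine ⟨e, ⟨⟨(Equiv.ofBijective _ hb).trans f.symm, ?_⟩⟩⟩
  intro u v
  rw [ha]
  simp only [Equiv.trans_apply, Equiv.ofBijective_apply, Finset.mem_filter, Finset.mem_univ,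
    true_and]
  exact ⟨Or.inl, fun h => h.elim id SimpleGraph.Adj.symm⟩

/-- A class of graphs (only its finite members are ever considered, all graphs being finite) has
bounded clique-width if there is a constant that bounds the clique-width of every member. -/
def BoundedCliqueWidth (C : ∀ V : Type, SimpleGraph V → Prop) : Prop :=
  ∃ c : ℕ, ∀ (V : Type) [Finite V] (G : SimpleGraph V), C V G → cliqueWidth G ≤ c

/-! ## Atoms -/

/-- `K` is a clique cut-set of `G`: a (possibly empty) clique such that `G ∖ K` is disconnected,
that is, contains two vertices with no path between them. -/
def IsCliqueCutset {V : Type*} (G : SimpleGraph V) (K : Set V) : Prop :=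
  G.IsClique K ∧ ¬ (G.induce Kᶜ).Preconnected

/-- An atom: a graph (with at least one vertex) that has no clique cut-set. -/
def IsGraphAtom {V : Type*} (G : SimpleGraph V) : Prop :=
  Nonempty V ∧ ∀ K : Set V, ¬ IsCliqueCutset G K

/-! ## Forbidden induced subgraphs -/

/-- `G` is `H`-free: it does not contain `H` as an induced subgraph. -/
def IndFree {W V : Type*} (H : SimpleGraph W) (G : SimpleGraph V) : Prop :=
  ¬ H.IsIndContained G

/-- The path on `t` vertices. -/
abbrev P (t : ℕ) : SimpleGraph (Fin t) := SimpleGraph.pathGraph t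

/-- The complete graph on `t` vertices. -/
abbrev K (t : ℕ) : SimpleGraph (Fin t) := SimpleGraph.completeGraph (Fin t)

/-- The disjoint union of `r` copies of `G`. -/
def copies {V : Type*} (r : ℕ) (G : SimpleGraph V) : SimpleGraph (Fin r × V) where
  Adj x y := x.1 = y.1 ∧ G.Adj x.2 y.2
  symm := ⟨fun _ _ h => ⟨h.1.symm, h.2.symm⟩⟩
  loopless := ⟨fun _ h => G.loopless.irrefl _ h.2⟩

/-- The diamond, that is, the complement of `2P₁ + P₂`. -/
abbrev diamond : SimpleGraph ((Fin 2 × Fin 1) ⊕ Fin 2) := (copies 2 (P 1) ⊕g P 2)ᶜ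

end CliqueWidthAtoms

/-! Both classes are witnessed by one family: `kagome n`, the line graph of the hexagonal lattice on
the `n × n` torus, and its complement. The hexagonal lattice is cubic without triangles or 4-cycles,
so its line graph has no induced claw, `K 4`, diamond or `C₄`; the second list of forbidden graphs
consists of the complements of these.

Clique-width: an expression with `k` labels contains a subexpression holding between one and two
thirds of the positions `(p, 0)`, and vertices of equal label have the same neighbours outside it
(`Constructible.exists_balanced`). This last property passes to the complement, so one argument
serves both graphs. As degrees are bounded, only O(k) rows and O(k) columns can meet both the part
and its complement. Away from their crossings all positions lie on the same side
(`kagome_isoperimetric`), so a balanced part forces n = O(k).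

Atoms: a clique lies in one fibre of `Prod.fst` or `head`, hence is too local to disconnect the
torus. In the complement, any two vertices have three common neighbours that are pairwise
nonadjacent, and a clique cannot contain them all. -/

namespace CliqueWidthAtoms

open SimpleGraph

/-! ## Balanced subexpressions -/

section Balanced

variable {k : ℕ} {V ι : Type*}

/-- Vertices of a part `f : α → V` with the same label have the same neighbours outside it. -/
def LabelsDetermineOutside {α : Type*} (G : SimpleGraph V) (f : α → V) (l : α → Fin k) : Prop :=
  ∀ u u', l u = l u' → ∀ v ∉ Set.range f, G.Adj (f u) v ↔ G.Adj (f u') v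

/-- A vertex outside the part differs from `f u` and `f u'`, so complementing negates both sides of
the equivalence. -/
theorem LabelsDetermineOutside.of_compl {α : Type*} {G : SimpleGraph V} {f : α → V}
    {l : α → Fin k} (h : LabelsDetermineOutside Gᶜ f l) : LabelsDetermineOutside G f l := by
  intro u u' huu v hv
  have := h u u' huu v hv
  have h1 : f u ≠ v := fun h => hv ⟨u, h⟩
  have h2 : f u' ≠ v := fun h => hv ⟨u', h⟩
  simp only [SimpleGraph.compl_adj] at this
  tauto

open Classical in
/-- The number of indices `i` with `g i` in the range of `f`. -/
noncomputable def weight [Fintype ι] (g : ι → V) {α : Type*} (f : α → V) : ℕ :=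
  (Finset.univ.filter fun i => g i ∈ Set.range f).card

theorem weight_sum_le [Fintype ι] (g : ι → V) {α β : Type*} (f : α ⊕ β → V) :
    weight g f ≤ weight g (f ∘ Sum.inl) + weight g (f ∘ Sum.inr) := by
  classical
  unfold weight
  refine (Finset.card_le_card ?_).trans (Finset.card_union_le _ _)
  intro i hi
  simp only [Finset.mem_filter, Finset.mem_univ, true_and, Finset.mem_union] at hi ⊢
  obtain ⟨x | x, hx⟩ := hi
  · exact Or.inl ⟨x, hx⟩
  · exact Or.inr ⟨x, hx⟩

/-- Descend while some child keeps more than two thirds of the weight. When a union has no such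
child, one of its two children still has more than one third. The relation `R` records the edges
added higher up in the expression, which depend only on the current labels: a join enlarges `R`, a
relabelling pulls it back. -/
theorem exists_balanced_of_context [Fintype ι] (G : SimpleGraph V) (g : ι → V)
    (hg : Function.Injective g) (hι : 2 ≤ Fintype.card ι) (e : CWExpr k) :
    ∀ f : e.Vert → V, Function.Injective f → LabelsDetermineOutside G f e.label →
      (∃ R : Fin k → Fin k → Prop, ∀ u w, u ≠ w →
        (G.Adj (f u) (f w) ↔ e.graph.Adj u w ∨ R (e.label u) (e.label w))) →
      2 * Fintype.card ι < 3 * weight g f →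
      ∃ (α : Type) (f' : α → V) (l : α → Fin k), LabelsDetermineOutside G f' l ∧
        Fintype.card ι < 3 * weight g f' ∧ 3 * weight g f' ≤ 2 * Fintype.card ι := by
  classical
  induction e with
  | single i =>
    intro f _ _ _ hw
    have : weight g f ≤ 1 := by
      unfold weight
      rw [Finset.card_le_one]
      simp only [Finset.mem_filter, Finset.mem_univ, true_and]
      rintro a ⟨x, hx⟩ b ⟨y, hy⟩
      exact hg (hx.symm.trans hy)
    omega
  | union a b iha ihb =>
    intro f hf ho ⟨R, hR⟩ hw
    have hsum := weight_sum_le g (α := a.Vert) (β := b.Vert) f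
    have hca : LabelsDetermineOutside G (fun x : a.Vert => f (Sum.inl x)) a.label := by
      intro u u' huu v hv
      by_cases hvf : v ∈ Set.range f
      · obtain ⟨x | x, rfl⟩ := hvf
        · exact absurd ⟨x, rfl⟩ hv
        · have h1 := hR (Sum.inl u) (Sum.inr x) Sum.inl_ne_inr
          have h2 := hR (Sum.inl u') (Sum.inr x) Sum.inl_ne_inr
          simp only [CWExpr.graph, CWExpr.label, Sum.elim_inl, Sum.elim_inr,
            SimpleGraph.sum_adj, huu] at h1 h2
          exact h1.trans h2.symm
      · exact ho (Sum.inl u) (Sum.inl u') huu v hvf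
    have hcb : LabelsDetermineOutside G (fun x : b.Vert => f (Sum.inr x)) b.label := by
      intro u u' huu v hv
      by_cases hvf : v ∈ Set.range f
      · obtain ⟨x | x, rfl⟩ := hvf
        · have h1 := hR (Sum.inr u) (Sum.inl x) Sum.inr_ne_inl
          have h2 := hR (Sum.inr u') (Sum.inl x) Sum.inr_ne_inl
          simp only [CWExpr.graph, CWExpr.label, Sum.elim_inl, Sum.elim_inr,
            SimpleGraph.sum_adj, huu] at h1 h2
          exact h1.trans h2.symm
        · exact absurd ⟨x, rfl⟩ hv
      · exact ho (Sum.inr u) (Sum.inr u') huu v hvf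
    by_cases ha : 2 * Fintype.card ι < 3 * weight g (fun x : a.Vert => f (Sum.inl x))
    · refine iha _ (hf.comp Sum.inl_injective) hca ⟨R, fun u w huw => ?_⟩ ha
      exact hR (Sum.inl u) (Sum.inl w) (Sum.inl_injective.ne huw)
    by_cases hb : 2 * Fintype.card ι < 3 * weight g (fun x : b.Vert => f (Sum.inr x))
    · refine ihb _ (hf.comp Sum.inr_injective) hcb ⟨R, fun u w huw => ?_⟩ hb
      exact hR (Sum.inr u) (Sum.inr w) (Sum.inr_injective.ne huw)
    change weight g f ≤ weight g (fun x : a.Vert => f (Sum.inl x)) +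
      weight g (fun x : b.Vert => f (Sum.inr x)) at hsum
    by_cases ha' : Fintype.card ι < 3 * weight g (fun x : a.Vert => f (Sum.inl x))
    · exact ⟨_, _, _, hca, ha', by omega⟩
    · exact ⟨_, _, _, hcb, by omega, by omega⟩
  | join i j hij a ih =>
    intro f hf ho ⟨R, hR⟩ hw
    refine ih f hf ho ⟨fun s t => (s = i ∧ t = j) ∨ (t = i ∧ s = j) ∨ R s t,
      fun u w huw => ?_⟩ hw
    refine (hR u w huw).trans ?_
    change (a.graph ⊔ SimpleGraph.fromRel
      fun u v => a.label u = i ∧ a.label v = j).Adj u w ∨ R (a.label u) (a.label w) ↔ _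
    rw [SimpleGraph.sup_adj, SimpleGraph.fromRel_adj]
    tauto
  | relabel i j a ih =>
    intro f hf ho ⟨R, hR⟩ hw
    refine ih f hf (fun u u' huu => ho u u' ?_)
      ⟨fun s t => R (if s = i then j else s) (if t = i then j else t), hR⟩ hw
    simp only [CWExpr.label, huu]

theorem Constructible.exists_balanced [Fintype ι] {G : SimpleGraph V} (h : Constructible G k)
    (g : ι → V) (hg : Function.Injective g) (hι : 2 ≤ Fintype.card ι) :
    ∃ (α : Type) (f : α → V) (l : α → Fin k), LabelsDetermineOutside G f l ∧
      Fintype.card ι < 3 * weight g f ∧ 3 * weight g f ≤ 2 * Fintype.card ι := by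
  classical
  obtain ⟨e, ⟨φ⟩⟩ := h
  refine exists_balanced_of_context G g hg hι e φ φ.injective
    (fun u u' _ v hv => absurd (φ.surjective v) hv) ⟨fun _ _ => False, fun u w _ => ?_⟩ ?_
  · simp [φ.map_adj_iff]
  · have : weight g φ = Fintype.card ι := by
      unfold weight
      simp [φ.surjective.range_eq]
    omega

theorem constructible_cliqueWidth [Finite V] [Nonempty V] (G : SimpleGraph V) :
    Constructible G (cliqueWidth G) :=
  Nat.sInf_mem (s := {k | Constructible G k}) ⟨_, exists_constructible G⟩

/-- If vertices have at most `D` neighbours, few values of `r` occur on the boundary. -/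
theorem LabelsDetermineOutside.card_boundary_le {α β : Type*} {G : SimpleGraph V} {f : α → V}
    {l : α → Fin k} (h : LabelsDetermineOutside G f l) {D : ℕ}
    (hD : ∀ v, ∃ s : Finset V, s.card ≤ D ∧ ∀ u, G.Adj u v → u ∈ s)
    (r : V → β) (M : Finset β)
    (hM : ∀ m ∈ M, ∃ u, ∃ v ∉ Set.range f, G.Adj (f u) v ∧ r (f u) = m) :
    M.card ≤ D * k := by
  classical
  rcases M.eq_empty_or_nonempty with rfl | ⟨m, hm⟩
  · simp
  obtain ⟨u₀, v₀, -⟩ := hM m hm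
  have : Nonempty α := ⟨u₀⟩
  have : Nonempty V := ⟨v₀⟩
  choose! u v hv huv hr using hM
  -- All chosen vertices `f (u m)` of one label share the outside neighbour `v m₀` of one of them,
  -- so each label accounts for at most `D` values.
  have h1 : M.card ≤ D * (M.image fun m => l (u m)).card := by
    refine Finset.card_le_mul_card_image M D fun a ha => ?_
    obtain ⟨m₀, hm₀, rfl⟩ := Finset.mem_image.1 ha
    obtain ⟨s, hs, hsu⟩ := hD (v m₀)
    refine (Finset.card_le_card (t := s.image r) ?_).trans (Finset.card_image_le.trans hs)
    intro m hm
    obtain ⟨hmM, hml⟩ := Finset.mem_filter.1 hm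
    exact Finset.mem_image.2 ⟨f (u m),
      hsu _ ((h _ _ hml _ (hv _ hm₀)).2 (huv _ hm₀)), hr _ hmM⟩
  refine h1.trans (Nat.mul_le_mul_left _ ?_)
  simpa using Finset.card_le_univ (M.image fun m => l (u m))

end Balanced

/-! ## The kagome lattice on a torus -/

/-- The displacement along the `d`-th type of edge of the hexagonal lattice. -/
def shift (n : ℕ) (d : Fin 3) : ZMod n × ZMod n := ![(0, 0), (1, 0), (0, 1)] d

theorem shift_zero {n : ℕ} : shift n 0 = 0 := rfl

/-- The second end of an edge of the hexagonal torus, the first end being `x.1`. -/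
def head {n : ℕ} (x : (ZMod n × ZMod n) × Fin 3) : ZMod n × ZMod n := x.1 + shift n x.2

/-- The line graph of the hexagonal lattice on the `n × n` torus. -/
def kagome (n : ℕ) : SimpleGraph ((ZMod n × ZMod n) × Fin 3) where
  Adj x y := x ≠ y ∧ (x.1 = y.1 ∨ head x = head y)
  symm := ⟨fun _ _ h => ⟨h.1.symm, h.2.imp Eq.symm Eq.symm⟩⟩
  loopless := ⟨fun _ h => h.1 rfl⟩

section Kagome

variable {n : ℕ}

theorem kagome_adj {x y : (ZMod n × ZMod n) × Fin 3} :
    (kagome n).Adj x y ↔ x ≠ y ∧ (x.1 = y.1 ∨ head x = head y) := Iff.rfl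

/-! ### Arithmetic of the three displacements -/

theorem zmod_one_ne_zero (hn : 7 ≤ n) : (1 : ZMod n) ≠ 0 := by
  have : Fact (1 < n) := ⟨by omega⟩
  exact one_ne_zero

theorem zmod_one_add_one_ne_zero (hn : 7 ≤ n) : (1 + 1 : ZMod n) ≠ 0 := by
  intro h
  have h2 : ((2 : ℕ) : ZMod n) = 0 := by rw [← h]; norm_num
  rw [ZMod.natCast_eq_zero_iff] at h2
  exact absurd (Nat.le_of_dvd (by norm_num) h2) (by omega)

theorem shift_injective (hn : 7 ≤ n) : Function.Injective (shift n) := by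
  have h1 := zmod_one_ne_zero hn
  intro a b h
  fin_cases a <;> fin_cases b <;> simp_all [shift]

/-- The displacements form a Sidon set; this rules out 4-cycles in the hexagonal lattice. -/
theorem shift_add_cancel (hn : 7 ≤ n) : ∀ a b c d : Fin 3,
    shift n a + shift n c = shift n b + shift n d → a = b ∨ a = d := by
  have h1 := zmod_one_ne_zero hn
  have h2 := zmod_one_add_one_ne_zero hn
  intro a b c d h
  fin_cases a <;> fin_cases b <;> fin_cases c <;> fin_cases d <;> simp_all [shift]

theorem eq_of_head_eq (hn : 7 ≤ n) {x y : (ZMod n × ZMod n) × Fin 3} (h1 : x.1 = y.1)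
    (h2 : head x = head y) : x = y := by
  refine Prod.ext h1 (shift_injective hn ?_)
  simpa [head, h1] using h2

theorem eq_of_head_eq_of_snd_eq {x y : (ZMod n × ZMod n) × Fin 3} (h1 : head x = head y)
    (h2 : x.2 = y.2) : x = y := by
  refine Prod.ext ?_ h2
  simpa [head, h2] using h1

/-! ### Forbidden subgraphs -/

/-- Each neighbour shares one of the two ends of `x`, so two of the three share the same end. -/
theorem kagome_no_claw {x y₁ y₂ y₃ : (ZMod n × ZMod n) × Fin 3} (h₁ : (kagome n).Adj x y₁)
    (h₂ : (kagome n).Adj x y₂) (h₃ : (kagome n).Adj x y₃) (d₁₂ : y₁ ≠ y₂) (d₁₃ : y₁ ≠ y₃)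
    (d₂₃ : y₂ ≠ y₃) (n₁₂ : ¬ (kagome n).Adj y₁ y₂) (n₁₃ : ¬ (kagome n).Adj y₁ y₃)
    (n₂₃ : ¬ (kagome n).Adj y₂ y₃) : False := by
  simp only [kagome_adj] at *
  grind

/-- Distinct edges `x`, `y` share only one end, and every common neighbour must pass through it. -/
theorem kagome_no_diamond (hn : 7 ≤ n) {u v x y : (ZMod n × ZMod n) × Fin 3}
    (hxy : (kagome n).Adj x y) (hux : (kagome n).Adj u x) (huy : (kagome n).Adj u y)
    (hvx : (kagome n).Adj v x) (hvy : (kagome n).Adj v y) (huv : u ≠ v)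
    (hn' : ¬ (kagome n).Adj u v) : False := by
  have h := @eq_of_head_eq n hn
  simp only [kagome_adj] at *
  grind

theorem fin3_pigeonhole (a b c d : Fin 3) :
    a = b ∨ a = c ∨ a = d ∨ b = c ∨ b = d ∨ c = d := by
  omega

theorem kagome_no_K4 (hn : 7 ≤ n) {x y z w : (ZMod n × ZMod n) × Fin 3}
    (hxy : (kagome n).Adj x y) (hxz : (kagome n).Adj x z) (hxw : (kagome n).Adj x w)
    (hyz : (kagome n).Adj y z) (hyw : (kagome n).Adj y w) (hzw : (kagome n).Adj z w) :
    False := by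
  have h := @eq_of_head_eq n hn
  have h' := @eq_of_head_eq_of_snd_eq n
  have h'' := fun x y : (ZMod n × ZMod n) × Fin 3 => @Prod.ext _ _ x y
  have hp := fin3_pigeonhole x.2 y.2 z.2 w.2
  simp only [kagome_adj] at *
  have : (x.1 = y.1 ∧ x.1 = z.1 ∧ x.1 = w.1) ∨
      (head x = head y ∧ head x = head z ∧ head x = head w) := by grind
  grind

theorem kagome_no_C4 (hn : 7 ≤ n) {x y z w : (ZMod n × ZMod n) × Fin 3}
    (hxy : (kagome n).Adj x y) (hyz : (kagome n).Adj y z) (hzw : (kagome n).Adj z w)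
    (hwx : (kagome n).Adj w x) (dxz : x ≠ z) (dyw : y ≠ w) (nxz : ¬ (kagome n).Adj x z)
    (nyw : ¬ (kagome n).Adj y w) : False := by
  have key : ∀ {x y z w : (ZMod n × ZMod n) × Fin 3}, x ≠ y → y ≠ z → z ≠ w → w ≠ x →
      x.1 = y.1 → head y = head z → z.1 = w.1 → head w = head x → False := by
    intro x y z w h1 h2 h3 h4 a1 b2 a3 b4
    have hs : shift n x.2 + shift n z.2 = shift n y.2 + shift n w.2 := by
      unfold head at b2 b4
      rw [a1] at b4
      rw [a3] at b2
      have : y.1 + w.1 + (shift n x.2 + shift n z.2) = y.1 + w.1 + (shift n y.2 + shift n w.2) := by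
        linear_combination (exp := 1) -b2 - b4
      exact add_left_cancel this
    rcases shift_add_cancel hn _ _ _ _ hs with h | h
    · exact h1 (Prod.ext a1 h)
    · exact h4 (eq_of_head_eq_of_snd_eq b4 h.symm)
  simp only [kagome_adj] at *
  -- Two consecutive adjacencies through the same kind of end would give a chord, so the kinds
  -- alternate.
  have : (x.1 = y.1 ∧ head y = head z ∧ z.1 = w.1 ∧ head w = head x) ∨
      (y.1 = z.1 ∧ head z = head w ∧ w.1 = x.1 ∧ head x = head y) := by grind
  rcases this with ⟨a, b, c, d⟩ | ⟨a, b, c, d⟩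
  · exact key hxy.1 hyz.1 hzw.1 hwx.1 a b c d
  · exact key hyz.1 hzw.1 hwx.1 hxy.1 a b c d

/-! ### Rows and columns -/

theorem adj_center (p : ZMod n × ZMod n) {d : Fin 3} (hd : d ≠ 0) :
    (kagome n).Adj (p, 0) (p, d) :=
  ⟨fun h => hd (congrArg Prod.snd h).symm, Or.inl rfl⟩

theorem adj_next_center (p : ZMod n × ZMod n) {d : Fin 3} (hd : d ≠ 0) :
    (kagome n).Adj (p, d) (p + shift n d, 0) := by
  refine ⟨fun h => hd (congrArg Prod.snd h), Or.inr ?_⟩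
  simp [head, shift]

/-- A property preserved by steps along row `y` spreads to the whole row. -/
theorem row_induction [NeZero n] {Q : ZMod n × ZMod n → Prop} {y : ZMod n}
    (h : ∀ x, Q (x, y) → Q (x + 1, y)) {x : ZMod n} (hx : Q (x, y)) (x' : ZMod n) :
    Q (x', y) := by
  have key : ∀ k : ℕ, Q (x + k, y) := by
    intro k
    induction k with
    | zero => simpa using hx
    | succ k ih =>
      have := h _ ih
      rwa [add_assoc, ← Nat.cast_succ] at this
  have := key (x' - x).val
  rwa [ZMod.natCast_zmod_val, add_sub_cancel] at this

theorem column_induction [NeZero n] {Q : ZMod n × ZMod n → Prop} {x : ZMod n}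
    (h : ∀ y, Q (x, y) → Q (x, y + 1)) {y : ZMod n} (hy : Q (x, y)) (y' : ZMod n) :
    Q (x, y') :=
  row_induction (Q := fun p => Q p.swap) (y := x) h hy y'

theorem shift_one (p : ZMod n × ZMod n) : p + shift n 1 = (p.1 + 1, p.2) := by
  ext <;> simp [shift]

theorem shift_two (p : ZMod n × ZMod n) : p + shift n 2 = (p.1, p.2 + 1) := by
  ext <;> simp [shift]

theorem exists_neighbors [NeZero n] (v : (ZMod n × ZMod n) × Fin 3) :
    ∃ s : Finset ((ZMod n × ZMod n) × Fin 3), s.card ≤ 6 ∧ ∀ u, (kagome n).Adj u v → u ∈ s := by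
  classical
  refine ⟨Finset.univ.image (fun d => (v.1, d)) ∪
    Finset.univ.image (fun d => (head v - shift n d, d)), ?_, ?_⟩
  · refine (Finset.card_union_le _ _).trans ?_
    have h1 := Finset.card_image_le (s := (Finset.univ : Finset (Fin 3)))
      (f := fun d => (v.1, d))
    have h2 := Finset.card_image_le (s := (Finset.univ : Finset (Fin 3)))
      (f := fun d => (head v - shift n d, d))
    simp only [Finset.card_univ, Fintype.card_fin] at h1 h2
    omega
  · rintro u ⟨_, h | h⟩
    · refine Finset.mem_union_left _ (Finset.mem_image.2 ⟨u.2, Finset.mem_univ _, ?_⟩)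
      rw [← h]
    · refine Finset.mem_union_right _ (Finset.mem_image.2 ⟨u.2, Finset.mem_univ _, ?_⟩)
      rw [← h, head, add_sub_cancel_right]

/-! ### Clique-width -/

/-- One step along a row or a column either stays inside `X` or meets the boundary of `X`. -/
theorem exists_boundary_of_step {X : Set ((ZMod n × ZMod n) × Fin 3)}
    {p : ZMod n × ZMod n} {d : Fin 3} (hd : d ≠ 0) (hp : (p, 0) ∈ X)
    (hq : (p + shift n d, 0) ∉ X) :
    ∃ u ∈ X, ∃ v ∉ X, (kagome n).Adj u v ∧ u.1 = p := by
  by_cases h : (p, d) ∈ X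
  · exact ⟨_, h, _, hq, adj_next_center p hd, rfl⟩
  · exact ⟨_, hp, _, h, adj_center p hd, rfl⟩

/-- `R` and `C` are the rows and columns met by both sides. Each contains the position of a boundary
edge, so `card_boundary_le` with degree bound 6 applies. -/
theorem kagome_isoperimetric [NeZero n] {k : ℕ} {α : Type*}
    {f : α → (ZMod n × ZMod n) × Fin 3} {l : α → Fin k}
    (h : LabelsDetermineOutside (kagome n) f l) :
    weight (fun p : ZMod n × ZMod n => (p, (0 : Fin 3))) f ≤ (6 * k) ^ 2 ∨
      n ^ 2 ≤ weight (fun p : ZMod n × ZMod n => (p, (0 : Fin 3))) f + (6 * k) ^ 2 := by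
  classical
  let Q : ZMod n × ZMod n → Prop := fun p => (p, 0) ∈ Set.range f
  let R : Finset (ZMod n) := Finset.univ.filter fun y => ∃ x x', Q (x, y) ∧ ¬ Q (x', y)
  let C : Finset (ZMod n) := Finset.univ.filter fun x => ∃ y y', Q (x, y) ∧ ¬ Q (x, y')
  have hR : R.card ≤ 6 * k := by
    refine h.card_boundary_le exists_neighbors (fun v => v.1.2) R fun y hy => ?_
    obtain ⟨x, x', hx, hx'⟩ := (Finset.mem_filter.1 hy).2
    by_contra hcon
    refine hx' (row_induction (Q := Q) (fun z hz => ?_) hx x')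
    by_contra hz'
    obtain ⟨_, ⟨u, rfl⟩, v, hv, huv, hu⟩ := exists_boundary_of_step (d := 1) (by decide) hz
      (by rw [shift_one]; exact hz')
    exact hcon ⟨u, v, hv, huv, by rw [hu]⟩
  have hC : C.card ≤ 6 * k := by
    refine h.card_boundary_le exists_neighbors (fun v => v.1.1) C fun x hx => ?_
    obtain ⟨y, y', hy, hy'⟩ := (Finset.mem_filter.1 hx).2
    by_contra hcon
    refine hy' (column_induction (Q := Q) (fun z hz => ?_) hy y')
    by_contra hz'
    obtain ⟨_, ⟨u, rfl⟩, v, hv, huv, hu⟩ := exists_boundary_of_step (d := 2) (by decide) hz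
      (by rw [shift_two]; exact hz')
    exact hcon ⟨u, v, hv, huv, by rw [hu]⟩
  by_cases hnB : n ≤ 6 * k
  · exact Or.inr ((Nat.pow_le_pow_left hnB 2).trans (Nat.le_add_left _ _))
  have hprod : (C ×ˢ R).card ≤ (6 * k) ^ 2 := by
    rw [Finset.card_product, pow_two]
    exact Nat.mul_le_mul hC hR
  have hRne : ∃ y, y ∉ R := by
    by_contra! hall
    have : R = Finset.univ := Finset.eq_univ_iff_forall.2 hall
    rw [this, Finset.card_univ, ZMod.card] at hR
    exact hnB hR
  have hCne : ∃ x, x ∉ C := by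
    by_contra! hall
    have : C = Finset.univ := Finset.eq_univ_iff_forall.2 hall
    rw [this, Finset.card_univ, ZMod.card] at hC
    exact hnB hC
  obtain ⟨y₀, hy₀⟩ := hRne
  obtain ⟨x₀, hx₀⟩ := hCne
  have hRow : ∀ {y}, y ∉ R → ∀ x x', Q (x, y) → Q (x', y) := fun hy x x' hx => by
    by_contra hx'
    exact hy (Finset.mem_filter.2 ⟨Finset.mem_univ _, x, x', hx, hx'⟩)
  have hCol : ∀ {x}, x ∉ C → ∀ y y', Q (x, y) → Q (x, y') := fun hx y y' hy => by
    by_contra hy'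
    exact hx (Finset.mem_filter.2 ⟨Finset.mem_univ _, y, y', hy, hy'⟩)
  -- Such a `p` lies on an uncut row or column, which crosses the uncut column `x₀` or row `y₀`.
  have hout : ∀ p ∉ C ×ˢ R, (Q p ↔ Q (x₀, y₀)) := by
    rintro ⟨x, y⟩ hp
    rw [Finset.mem_product, not_and_or] at hp
    rcases hp with hp | hp
    · exact ⟨fun h => hRow hy₀ x x₀ (hCol hp y y₀ h), fun h => hCol hp y₀ y (hRow hy₀ x₀ x h)⟩
    · exact ⟨fun h => hCol hx₀ y y₀ (hRow hp x x₀ h), fun h => hRow hp x₀ x (hCol hx₀ y₀ y h)⟩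
  by_cases h0 : Q (x₀, y₀)
  · right
    have hle : (Finset.univ : Finset (ZMod n × ZMod n)).card ≤
        ((Finset.univ.filter fun p => Q p) ∪ C ×ˢ R).card := by
      refine Finset.card_le_card fun p _ => ?_
      rw [Finset.mem_union]
      by_cases hp : p ∈ C ×ˢ R
      · exact Or.inr hp
      · exact Or.inl (Finset.mem_filter.2 ⟨Finset.mem_univ _, (hout p hp).2 h0⟩)
    rw [Finset.card_univ, Fintype.card_prod, ZMod.card, ← pow_two] at hle
    exact hle.trans ((Finset.card_union_le _ _).trans (Nat.add_le_add_left hprod _))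
  · left
    refine (Finset.card_le_card fun p hp => ?_).trans hprod
    by_contra hp'
    exact h0 ((hout p hp').1 (Finset.mem_filter.1 hp).2)

theorem sq_le_of_constructible [NeZero n] (hn : 7 ≤ n) {k : ℕ}
    {G : SimpleGraph ((ZMod n × ZMod n) × Fin 3)}
    (hG : ∀ {α : Type} {f : α → (ZMod n × ZMod n) × Fin 3} {l : α → Fin k},
      LabelsDetermineOutside G f l → LabelsDetermineOutside (kagome n) f l)
    (h : Constructible G k) : n ^ 2 ≤ 3 * (6 * k) ^ 2 := by
  have hcard : Fintype.card (ZMod n × ZMod n) = n ^ 2 := by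
    rw [Fintype.card_prod, ZMod.card, pow_two]
  obtain ⟨α, f, l, hl, h1, h2⟩ := h.exists_balanced
    (fun p : ZMod n × ZMod n => (p, (0 : Fin 3))) (fun p q h => congrArg Prod.fst h)
    (by rw [hcard]; nlinarith)
  rw [hcard] at h1 h2
  rcases kagome_isoperimetric (hG hl) with h | h <;> omega

theorem lt_cliqueWidth_kagome {c : ℕ} (hn : n = 11 * c + 11) : c < cliqueWidth (kagome n) := by
  have : NeZero n := ⟨by omega⟩
  by_contra! hc
  have := sq_le_of_constructible (by omega) (fun h => h) (constructible_cliqueWidth (kagome n))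
  have h2 := Nat.pow_le_pow_left hc 2
  -- The factor 11 is chosen because 11² = 121 exceeds 3 · 6² = 108.
  subst hn
  nlinarith

theorem lt_cliqueWidth_kagome_compl {c : ℕ} (hn : n = 11 * c + 11) :
    c < cliqueWidth (kagome n)ᶜ := by
  have : NeZero n := ⟨by omega⟩
  by_contra! hc
  have := sq_le_of_constructible (by omega) (fun h => h.of_compl)
    (constructible_cliqueWidth (kagome n)ᶜ)
  have h2 := Nat.pow_le_pow_left hc 2
  subst hn
  nlinarith

/-! ### Clique cut-sets -/

theorem kagome_clique_subset_fiber {K : Set ((ZMod n × ZMod n) × Fin 3)}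
    (hK : (kagome n).IsClique K) : ∃ p, (∀ x ∈ K, x.1 = p) ∨ ∀ x ∈ K, head x = p := by
  by_cases h : ∃ x ∈ K, ∃ y ∈ K, x.1 ≠ y.1
  · obtain ⟨x, hx, y, hy, hxy⟩ := h
    have adj : ∀ {u v}, u ∈ K → v ∈ K → u ≠ v → u.1 = v.1 ∨ head u = head v :=
      fun hu hv huv => (hK hu hv huv).2
    refine ⟨head x, Or.inr fun z hz => ?_⟩
    grind
  · push Not at h
    rcases K.eq_empty_or_nonempty with rfl | ⟨x, hx⟩
    · exact ⟨0, Or.inl (by simp)⟩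
    · exact ⟨x.1, Or.inl fun y hy => h y hy x hx⟩

/-- `x` and `y` are joined by a path of `G` that avoids `K`. -/
def ReachableAvoiding {V : Type*} (G : SimpleGraph V) (K : Set V) (x y : V) : Prop :=
  ∃ (hx : x ∈ Kᶜ) (hy : y ∈ Kᶜ), (G.induce Kᶜ).Reachable ⟨x, hx⟩ ⟨y, hy⟩

namespace ReachableAvoiding

variable {V : Type*} {G : SimpleGraph V} {K : Set V} {x y z : V}

theorem refl (hx : x ∉ K) : ReachableAvoiding G K x x := ⟨hx, hx, .refl _⟩

theorem symm (h : ReachableAvoiding G K x y) : ReachableAvoiding G K y x :=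
  let ⟨hx, hy, h⟩ := h
  ⟨hy, hx, h.symm⟩

theorem trans (h : ReachableAvoiding G K x y) (h' : ReachableAvoiding G K y z) :
    ReachableAvoiding G K x z :=
  let ⟨hx, _, h⟩ := h
  let ⟨_, hz, h'⟩ := h'
  ⟨hx, hz, h.trans h'⟩

theorem of_adj (hx : x ∉ K) (hy : y ∉ K) (h : G.Adj x y) : ReachableAvoiding G K x y :=
  ⟨hx, hy, SimpleGraph.Adj.reachable (G := G.induce Kᶜ) (u := ⟨x, hx⟩) (v := ⟨y, hy⟩) h⟩

theorem preconnected (h : ∀ x ∉ K, ∀ y ∉ K, ReachableAvoiding G K x y) :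
    (G.induce Kᶜ).Preconnected := fun x y =>
  let ⟨_, _, h⟩ := h x x.2 y y.2
  h

end ReachableAvoiding

/-- The hypotheses cover both kinds of fibre over `p₀`. They leave every row and column not through
`p₀` free of `K`; the starting centre lies on such a row and such a column, and any other `p ≠ p₀`
lies on at least one. -/
theorem kagome_reachable_center_of_ne [NeZero n] (hn : 7 ≤ n)
    {K : Set ((ZMod n × ZMod n) × Fin 3)} {p₀ : ZMod n × ZMod n}
    (h0 : ∀ p, (p, 0) ∈ K → p = p₀) (h1 : ∀ p, (p, 1) ∈ K → p.2 = p₀.2)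
    (h2 : ∀ p, (p, 2) ∈ K → p.1 = p₀.1) {p : ZMod n × ZMod n} (hp : p ≠ p₀) :
    ReachableAvoiding (kagome n) K ((p₀.1 + 1, p₀.2 + 1), 0) (p, 0) := by
  have hone := zmod_one_ne_zero hn
  have row : ∀ {y}, y ≠ p₀.2 → ∀ x x',
      ReachableAvoiding (kagome n) K ((x, y), 0) ((x', y), 0) := by
    intro y hy x x'
    have c0 : ∀ z, ((z, y), 0) ∉ K := fun z hz => hy (congrArg Prod.snd (h0 _ hz))
    have c1 : ∀ z, ((z, y), 1) ∉ K := fun z hz => hy (h1 _ hz)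
    refine row_induction (Q := fun q => ReachableAvoiding (kagome n) K ((x, y), 0) (q, 0))
      (fun z hz => hz.trans ?_) (.refl (c0 x)) x'
    have := adj_next_center (n := n) (z, y) (d := 1) (by decide)
    rw [shift_one] at this
    exact (ReachableAvoiding.of_adj (c0 z) (c1 z) (adj_center _ (by decide))).trans
      (.of_adj (c1 z) (c0 _) this)
  have col : ∀ {x}, x ≠ p₀.1 → ∀ y y',
      ReachableAvoiding (kagome n) K ((x, y), 0) ((x, y'), 0) := by
    intro x hx y y'
    have c0 : ∀ z, ((x, z), 0) ∉ K := fun z hz => hx (congrArg Prod.fst (h0 _ hz))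
    have c2 : ∀ z, ((x, z), 2) ∉ K := fun z hz => hx (h2 _ hz)
    refine column_induction (Q := fun q => ReachableAvoiding (kagome n) K ((x, y), 0) (q, 0))
      (fun z hz => hz.trans ?_) (.refl (c0 y)) y'
    have := adj_next_center (n := n) (x, z) (d := 2) (by decide)
    rw [shift_two] at this
    exact (ReachableAvoiding.of_adj (c0 z) (c2 z) (adj_center _ (by decide))).trans
      (.of_adj (c2 z) (c0 _) this)
  obtain ⟨x, y⟩ := p
  by_cases hy : y = p₀.2
  · have hx : x ≠ p₀.1 := fun hx => hp (Prod.ext hx hy)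
    exact (row (by simpa using hone) _ x).trans (col hx _ _)
  · exact (col (by simpa using hone) _ y).trans (row hy _ _)

theorem kagome_isGraphAtom (hn : 7 ≤ n) : IsGraphAtom (kagome n) := by
  have : NeZero n := ⟨by omega⟩
  have hinj := shift_injective hn
  refine ⟨⟨(0, 0)⟩, fun K ⟨hK, hdis⟩ => hdis ?_⟩
  -- The last clause keeps a neighbour of `(p₀, 0)` outside `K`, needed to reach that centre itself.
  obtain ⟨p₀, h0, h1, h2, h3⟩ : ∃ p₀ : ZMod n × ZMod n, (∀ p, (p, 0) ∈ K → p = p₀) ∧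
      (∀ p, (p, 1) ∈ K → p.2 = p₀.2) ∧ (∀ p, (p, 2) ∈ K → p.1 = p₀.1) ∧
      ((p₀, 1) ∉ K ∨ (p₀ - shift n 1, 1) ∉ K) := by
    obtain ⟨p₀, h | h⟩ := kagome_clique_subset_fiber hK
    · refine ⟨p₀, fun p hp => h _ hp, fun p hp => ?_, fun p hp => ?_, Or.inr fun hp => ?_⟩
      · rw [← h _ hp]
      · rw [← h _ hp]
      · have := h _ hp
        simp [shift, Prod.ext_iff, zmod_one_ne_zero hn] at this
    · refine ⟨p₀, fun p hp => ?_, fun p hp => ?_, fun p hp => ?_, Or.inl fun hp => ?_⟩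
      · simpa [head, shift_zero] using h _ hp
      · simp [← h _ hp, head, shift]
      · simp [← h _ hp, head, shift]
      · have := h _ hp
        simp [head, shift, Prod.ext_iff, zmod_one_ne_zero hn] at this
  have hs : ∀ d : Fin 3, d ≠ 0 → shift n d ≠ 0 := fun d hd h => hd (hinj (h.trans shift_zero.symm))
  have hub : ∀ {p}, p ≠ p₀ → ReachableAvoiding (kagome n) K ((p₀.1 + 1, p₀.2 + 1), 0) (p, 0) :=
    fun hp => kagome_reachable_center_of_ne hn h0 h1 h2 hp
  have c0 : ∀ {p}, p ≠ p₀ → (p, (0 : Fin 3)) ∉ K := fun hp h => hp (h0 _ h)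
  have all : ∀ x ∉ K, ReachableAvoiding (kagome n) K ((p₀.1 + 1, p₀.2 + 1), 0) x := by
    have side : ∀ p d, d ≠ 0 → (p, d) ∉ K →
        ReachableAvoiding (kagome n) K ((p₀.1 + 1, p₀.2 + 1), 0) (p, d) := by
      intro p d hd hx
      by_cases hp : p = p₀
      · have hp' : p + shift n d ≠ p₀ := by simpa [hp] using hs d hd
        exact (hub hp').trans (.of_adj (c0 hp') hx (adj_next_center p hd).symm)
      · exact (hub hp).trans (.of_adj (c0 hp) hx (adj_center p hd))
    rintro ⟨p, d⟩ hx
    by_cases hd : d = 0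
    · subst hd
      by_cases hp : p = p₀
      · subst hp
        rcases h3 with h | h
        · exact (side _ _ (by decide) h).trans
            (.of_adj h hx (adj_center p (by decide)).symm)
        · refine (side _ _ (by decide) h).trans (.of_adj h hx ?_)
          simpa using adj_next_center (p - shift n 1) (d := 1) (by decide)
      · exact hub hp
    · exact side p d hd hx
  exact ReachableAvoiding.preconnected fun x hx y hy => (all x hx).symm.trans (all y hy)

theorem kagome_exists_position (hn : 7 ≤ n) (u v : (ZMod n × ZMod n) × Fin 3) :
    ∃ p : ZMod n × ZMod n, ∀ d : Fin 3, (kagome n)ᶜ.Adj u (p, d) ∧ (kagome n)ᶜ.Adj (p, d) v := by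
  have : NeZero n := ⟨by omega⟩
  -- Six first coordinates are excluded, hence `7 ≤ n`; the `- 1` terms are there because the head
  -- of `((t, 0), d)` may have first coordinate `t + 1`.
  obtain ⟨t, -, ht⟩ := Finset.exists_mem_notMem_of_card_lt_card
    (s := {u.1.1, v.1.1, (head u).1, (head u).1 - 1, (head v).1, (head v).1 - 1})
    (t := (Finset.univ : Finset (ZMod n)))
    (Finset.card_le_six.trans_lt (by rw [Finset.card_univ, ZMod.card]; omega))
  simp only [Finset.mem_insert, Finset.mem_singleton, not_or] at ht
  obtain ⟨t1, t2, t3, t4, t5, t6⟩ := ht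
  have hhead : ∀ d : Fin 3, (head (((t, 0), d) : (ZMod n × ZMod n) × Fin 3)).1 = t ∨
      (head (((t, 0), d) : (ZMod n × ZMod n) × Fin 3)).1 = t + 1 := by
    intro d
    fin_cases d <;> simp [head, shift]
  have key : ∀ (w : (ZMod n × ZMod n) × Fin 3) (d : Fin 3), t ≠ w.1.1 → t ≠ (head w).1 →
      t ≠ (head w).1 - 1 → (kagome n)ᶜ.Adj w ((t, 0), d) := by
    intro w d a b c
    have a' : w.1 ≠ (t, 0) := fun h => a (by rw [h])
    rw [SimpleGraph.compl_adj, kagome_adj]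
    refine ⟨fun h => a' (by rw [h]), fun ⟨_, h⟩ => h.elim a' fun h => ?_⟩
    rw [h] at b c
    rcases hhead d with h' | h'
    · exact b h'.symm
    · exact c (by rw [h', add_sub_cancel_right])
  exact ⟨(t, 0), fun d => ⟨key u d t1 t3 t4, (key v d t2 t5 t6).symm⟩⟩

theorem kagome_compl_isGraphAtom (hn : 7 ≤ n) : IsGraphAtom (kagome n)ᶜ := by
  refine ⟨⟨(0, 0)⟩, fun K ⟨hK, hdis⟩ => hdis ?_⟩
  refine ReachableAvoiding.preconnected fun u hu v hv => ?_
  obtain ⟨p, hp⟩ := kagome_exists_position hn u v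
  obtain ⟨d, hd⟩ : ∃ d : Fin 3, (p, d) ∉ K := by
    by_contra! hall
    have h01 : ((p, 0) : (ZMod n × ZMod n) × Fin 3) ≠ (p, 1) := by simp
    have := hK (hall 0) (hall 1) h01
    rw [SimpleGraph.compl_adj, kagome_adj] at this
    exact this.2 ⟨h01, Or.inl rfl⟩
  exact (ReachableAvoiding.of_adj hu hd (hp d).1).trans (.of_adj hd hv (hp d).2)

end Kagome

/-! ### Freeness -/

section Free

variable {n : ℕ}

theorem kagome_indFree_cycle (hn : 7 ≤ n) : IndFree (cycleGraph 4) (kagome n) := by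
  rintro ⟨f⟩
  have a : ∀ i j, (cycleGraph 4).Adj i j → (kagome n).Adj (f i) (f j) := fun i j => f.map_adj_iff.2
  have b : ∀ i j, ¬ (cycleGraph 4).Adj i j → ¬ (kagome n).Adj (f i) (f j) :=
    fun i j h h' => h (f.map_adj_iff.1 h')
  exact kagome_no_C4 hn (a 0 1 (by decide)) (a 1 2 (by decide)) (a 2 3 (by decide))
    (a 3 0 (by decide)) (f.injective.ne (by decide)) (f.injective.ne (by decide))
    (b 0 2 (by decide)) (b 1 3 (by decide))

theorem kagome_indFree_claw : IndFree (completeBipartiteGraph (Fin 1) (Fin 3)) (kagome n) := by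
  rintro ⟨f⟩
  have a : ∀ i : Fin 3, (kagome n).Adj (f (.inl 0)) (f (.inr i)) :=
    fun i => f.map_adj_iff.2 (by simp)
  have b : ∀ i j : Fin 3, ¬ (kagome n).Adj (f (.inr i)) (f (.inr j)) :=
    fun i j h => by simpa using f.map_adj_iff.1 h
  exact kagome_no_claw (a 0) (a 1) (a 2) (f.injective.ne (by decide)) (f.injective.ne (by decide))
    (f.injective.ne (by decide)) (b 0 1) (b 0 2) (b 1 2)

theorem kagome_indFree_K4 (hn : 7 ≤ n) : IndFree (K 4) (kagome n) := by
  rintro ⟨f⟩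
  have a : ∀ i j : Fin 4, i ≠ j → (kagome n).Adj (f i) (f j) :=
    fun i j h => f.map_adj_iff.2 h
  exact kagome_no_K4 hn (a 0 1 (by decide)) (a 0 2 (by decide)) (a 0 3 (by decide))
    (a 1 2 (by decide)) (a 1 3 (by decide)) (a 2 3 (by decide))

theorem kagome_indFree_diamond (hn : 7 ≤ n) : IndFree diamond (kagome n) := by
  rintro ⟨f⟩
  have p1 : (P 2).Adj 0 1 := by simp [pathGraph_adj]
  refine kagome_no_diamond hn (x := f (.inl (0, 0))) (y := f (.inl (1, 0))) (u := f (.inr 0))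
    (v := f (.inr 1)) (f.map_adj_iff.2 ?_) (f.map_adj_iff.2 ?_) (f.map_adj_iff.2 ?_)
    (f.map_adj_iff.2 ?_) (f.map_adj_iff.2 ?_) (f.injective.ne (by decide))
    (fun h => ?_)
  · simp [SimpleGraph.compl_adj, copies]
  · simp [SimpleGraph.compl_adj]
  · simp [SimpleGraph.compl_adj]
  · simp [SimpleGraph.compl_adj]
  · simp [SimpleGraph.compl_adj]
  · have := f.map_adj_iff.1 h
    rw [SimpleGraph.compl_adj] at this
    exact this.2 p1

theorem adj_of_not_compl_adj {V W : Type*} {G : SimpleGraph V} {H : SimpleGraph W} (f : H ↪g Gᶜ)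
    {x y : W} (hne : x ≠ y) (h : ¬ H.Adj x y) : G.Adj (f x) (f y) := by
  have := mt (f.map_adj_iff (v := x) (w := y)).1 h
  rw [SimpleGraph.compl_adj] at this
  by_contra h'
  exact this ⟨f.injective.ne hne, h'⟩

theorem not_adj_of_compl_adj {V W : Type*} {G : SimpleGraph V} {H : SimpleGraph W} (f : H ↪g Gᶜ)
    {x y : W} (h : H.Adj x y) : ¬ G.Adj (f x) (f y) :=
  (f.map_adj_iff.2 h).2

theorem kagome_compl_indFree_two_P2 (hn : 7 ≤ n) : IndFree (copies 2 (P 2)) (kagome n)ᶜ := by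
  rintro ⟨f⟩
  have p1 : (P 2).Adj 0 1 := by simp [pathGraph_adj]
  have a : ∀ i j s t, i ≠ j → (kagome n).Adj (f (i, s)) (f (j, t)) := fun i j s t h =>
    adj_of_not_compl_adj f (fun h' => h (congrArg Prod.fst h')) fun h' => h h'.1
  have b : ∀ i, ¬ (kagome n).Adj (f (i, 0)) (f (i, 1)) := fun i =>
    not_adj_of_compl_adj f ⟨rfl, p1⟩
  -- The 4-cycle alternates between the two copies of `P 2`, whose edges become its missing
  -- diagonals.
  exact kagome_no_C4 hn (a 0 1 0 0 (by decide)) (a 1 0 0 1 (by decide)) (a 0 1 1 1 (by decide))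
    (a 1 0 1 0 (by decide)) (f.injective.ne (by decide)) (f.injective.ne (by decide)) (b 0) (b 1)

theorem kagome_compl_indFree_K3_add_P1 : IndFree (SimpleGraph.sum (K 3) (P 1)) (kagome n)ᶜ := by
  rintro ⟨f⟩
  have a : ∀ i : Fin 3, (kagome n).Adj (f (.inr 0)) (f (.inl i)) := fun i =>
    adj_of_not_compl_adj f (by simp) (by simp)
  have b : ∀ i j : Fin 3, i ≠ j → ¬ (kagome n).Adj (f (.inl i)) (f (.inl j)) := fun i j h =>
    not_adj_of_compl_adj f (by simpa using h)
  exact kagome_no_claw (a 0) (a 1) (a 2) (f.injective.ne (by decide)) (f.injective.ne (by decide))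
    (f.injective.ne (by decide)) (b 0 1 (by decide)) (b 0 2 (by decide)) (b 1 2 (by decide))

theorem kagome_compl_indFree_four_P1 (hn : 7 ≤ n) : IndFree (copies 4 (P 1)) (kagome n)ᶜ := by
  rintro ⟨f⟩
  have a : ∀ i j, i ≠ j → (kagome n).Adj (f (i, 0)) (f (j, 0)) := fun i j h =>
    adj_of_not_compl_adj f (fun h' => h (congrArg Prod.fst h')) fun h' => h h'.1
  exact kagome_no_K4 hn (a 0 1 (by decide)) (a 0 2 (by decide)) (a 0 3 (by decide))
    (a 1 2 (by decide)) (a 1 3 (by decide)) (a 2 3 (by decide))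

theorem kagome_compl_indFree_two_P1_add_P2 (hn : 7 ≤ n) :
    IndFree (SimpleGraph.sum (copies 2 (P 1)) (P 2)) (kagome n)ᶜ := by
  rintro ⟨f⟩
  have p1 : (P 2).Adj 0 1 := by simp [pathGraph_adj]
  have a : ∀ x y, (kagome n).Adj (f (.inr x)) (f (.inl y)) := fun x y =>
    adj_of_not_compl_adj f (by simp) (by simp)
  exact kagome_no_diamond hn (x := f (.inl (0, 0))) (y := f (.inl (1, 0))) (u := f (.inr 0))
    (v := f (.inr 1)) (adj_of_not_compl_adj f (by simp) (by simp [copies])) (a _ _) (a _ _)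
    (a _ _) (a _ _) (f.injective.ne (by decide)) (not_adj_of_compl_adj f (by simpa using p1))

end Free

end CliqueWidthAtoms

theorem mainTheorem11 :
    (¬ CliqueWidthAtoms.BoundedCliqueWidth fun _ G =>
      CliqueWidthAtoms.IsGraphAtom G ∧
        CliqueWidthAtoms.IndFree (SimpleGraph.cycleGraph 4) G ∧
        CliqueWidthAtoms.IndFree (completeBipartiteGraph (Fin 1) (Fin 3)) G ∧
        CliqueWidthAtoms.IndFree (CliqueWidthAtoms.K 4) G ∧
        CliqueWidthAtoms.IndFree CliqueWidthAtoms.diamond G) ∧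
    (¬ CliqueWidthAtoms.BoundedCliqueWidth fun _ G =>
      CliqueWidthAtoms.IsGraphAtom G ∧
        CliqueWidthAtoms.IndFree
          (CliqueWidthAtoms.copies 2 (CliqueWidthAtoms.P 2)) G ∧
        CliqueWidthAtoms.IndFree
          (SimpleGraph.sum (CliqueWidthAtoms.K 3) (CliqueWidthAtoms.P 1)) G ∧
        CliqueWidthAtoms.IndFree
          (CliqueWidthAtoms.copies 4 (CliqueWidthAtoms.P 1)) G ∧
        CliqueWidthAtoms.IndFree
          (SimpleGraph.sum (CliqueWidthAtoms.copies 2 (CliqueWidthAtoms.P 1))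
            (CliqueWidthAtoms.P 2)) G) := by
  refine ⟨fun ⟨c, hc⟩ => ?_, fun ⟨c, hc⟩ => ?_⟩
  · have : NeZero (11 * c + 11) := ⟨by omega⟩
    have hn : 7 ≤ 11 * c + 11 := by omega
    exact (CliqueWidthAtoms.lt_cliqueWidth_kagome rfl).not_ge
      (hc _ (CliqueWidthAtoms.kagome (11 * c + 11))
        ⟨CliqueWidthAtoms.kagome_isGraphAtom hn, CliqueWidthAtoms.kagome_indFree_cycle hn,
          CliqueWidthAtoms.kagome_indFree_claw, CliqueWidthAtoms.kagome_indFree_K4 hn,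
          CliqueWidthAtoms.kagome_indFree_diamond hn⟩)
  · have : NeZero (11 * c + 11) := ⟨by omega⟩
    have hn : 7 ≤ 11 * c + 11 := by omega
    exact (CliqueWidthAtoms.lt_cliqueWidth_kagome_compl rfl).not_ge
      (hc _ (CliqueWidthAtoms.kagome (11 * c + 11))ᶜ
        ⟨CliqueWidthAtoms.kagome_compl_isGraphAtom hn,
          CliqueWidthAtoms.kagome_compl_indFree_two_P2 hn,
          CliqueWidthAtoms.kagome_compl_indFree_K3_add_P1,
          CliqueWidthAtoms.kagome_compl_indFree_four_P1 hn,
          CliqueWidthAtoms.kagome_compl_indFree_two_P1_add_P2 hn⟩)
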